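/- Let $T$ be a finite rooted tree, i.e. a finite poset with a unique minimal element whose Hasse diagram is a tree. Fix a plane embedding of $T$ and label its leaves (maximal elements) $1,\dots,n$ from left to right. The interval of a vertex $x$ is the set $I$ of labels of leaves $z\ge x$. For such an interval $I$ let the branch $B_I$ be the set of vertices with interval $I$, let $\beta_I=\#B_I$, and let $\mathcal I(T)=\{(I,\beta_I)\}$, where $I$ runs over the intervals of the vertices. An $\mathcal I(T)$-partition of an interval $J\subseteq\{1,\dots,n\}$ is a partition of $J$ into intervals from $\mathcal I(T)$; it is proper if it is not $\{J\}$; partitions are ordered by refinement, the coarser being the larger. Rowmotion on antichains is the map $\rho(A)=\min\{x\in T: x\not\le a\text{ for all }a\in A\}$, where $\min$ denotes the set of minimal elements; it is a permutation of the set of antichains of $T$. Given an orbit $\mathcal O$ of $\rho$, let $\tau(\mathcal O)$ be the following tiling of a cylinder with rows $1,\dots,n$ and $\#\mathcal O$ columns in cyclic order. The columns correspond to the antichains $A,\rho(A),\rho^2(A),\dots$ of $\mathcal O$. In the column of $A$, for each $x\in A$ with interval $I$, the rows in $I$ are covered by a black tile, and each remaining cell by a yellow tile; black tiles in consecutive columns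 that come from the same interval are combined into one tile. An $\mathcal I(T)$-tiling is a tiling of a cylinder with $n$ rows and any positive number of columns by $I\times\beta_I$ black tiles, $(I,\beta_I)\in\mathcal I(T)$ (an $I\times b$ tile covers the rows in $I$ and $b$ consecutive columns), and $1\times 1$ yellow tiles, such that (t1) an $I\times\beta_I$ black tile is followed (in the next column) by a yellow tile if $\#I=1$, and by black tiles on the intervals of a maximal proper $\mathcal I(T)$-partition of $I$ if $\#I\ge 2$; (t2) if $J$ is a maximal interval of yellow tiles in a column, then these are followed by black tiles on the intervals of a maximal $\mathcal I(T)$-partition of $J$. Tilings are considered up to rotation of the cylinder (cyclic shift of the columns), and a tiling is called primitive if no nontrivial rotation maps it to itself (that is, it is not the repetition of a tiling with fewer columns). Theorem. The map $\mathcal O\mapsto\tau(\mathcal O)$ is a bijection from the set of rowmotion orbits on the antichains of $T$ onto the set of primitive $\mathcal I(T)$-tilings, up to rotation. -/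

import Mathlib

namespace TreeRowmotion

/-! ### Rowmotion on antichains of a finite poset -/

section Rowmotion

variable (P : Type*) [PartialOrder P]

/-- The antichains of a poset `P`. -/
abbrev Antichains : Type _ := {A : Set P // IsAntichain (· ≤ ·) A}

variable {P}

/-- The rowmotion map `ρ(A) = min {x ∉ A↓}` on antichains. -/
def rho (A : Antichains P) : Antichains P :=
  ⟨{x | Minimal (fun y => y ∉ lowerClosure A.1) x}, setOfPred_minimal_antichain _⟩

theorem rho_injective [Finite P] : Function.Injective (rho (P := P)) := by
  have key : ∀ A : Antichains P, ∀ y, y ∉ lowerClosure A.1 ↔ ∃ x ∈ (rho A).1, x ≤ y := by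
    intro A y
    constructor
    · intro hy
      obtain ⟨x, hxy, hx⟩ :=
        (Set.toFinite {z | z ∉ lowerClosure A.1}).exists_le_minimal hy
      exact ⟨x, hx, hxy⟩
    · rintro ⟨x, hx, hxy⟩ hy
      have hx' : Minimal (fun y => y ∉ lowerClosure A.1) x := hx
      exact hx'.prop ((lowerClosure A.1).lower hxy hy)
  have sub : ∀ A B : Antichains P, lowerClosure A.1 = lowerClosure B.1 → A.1 ⊆ B.1 := by
    intro A B h a ha
    have h1 : a ∈ lowerClosure B.1 := h ▸ subset_lowerClosure ha
    obtain ⟨b, hb, hab⟩ := mem_lowerClosure.1 h1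
    have h2 : b ∈ lowerClosure A.1 := h ▸ subset_lowerClosure hb
    obtain ⟨a', ha', hba⟩ := mem_lowerClosure.1 h2
    have haa : a = a' := A.2.eq ha ha' (hab.trans hba)
    have hb' : a = b := le_antisymm hab (haa ▸ hba)
    exact hb' ▸ hb
  intro A B h
  have hcl : lowerClosure A.1 = lowerClosure B.1 := by
    ext y
    have := key A y
    rw [h, ← key B y] at this
    exact not_iff_not.1 this
  exact Subtype.ext (Set.Subset.antisymm (sub A B hcl) (sub B A hcl.symm))

variable (P)

/-- Rowmotion as a permutation of the finite set of antichains. -/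
noncomputable def rowmotion [Finite P] : Equiv.Perm (Antichains P) :=
  Equiv.ofBijective rho (Finite.injective_iff_bijective.1 rho_injective)

/-- The orbits of the action generated by rowmotion: `A` and `B` lie in the same orbit
iff `B = ρ ^ k (A)` for some integer `k`. -/
abbrev Orbits [Finite P] : Type _ :=
  Quotient (Equiv.Perm.SameCycle.setoid (rowmotion P))

end Rowmotion

/-! ### Rooted trees, plane embeddings, intervals and branches -/

section Trees

variable (T : Type*) [PartialOrder T]

/-- The Hasse diagram is a tree, and there is a unique minimal element. -/
structure IsRootedTree : Prop where
  isTree : (SimpleGraph.hasse T).IsTree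
  existsUnique_root : ∃! r : T, IsMin r

/-- The leaves: maximal elements. -/
abbrev Leaf : Type _ := {x : T // IsMax x}

/-- A plane embedding of (the Hasse diagram of) a rooted tree, up to deformation: a left-to-right
linear order on the children of every vertex. -/
structure PlaneEmbedding where
  childOrder : ∀ w : T, LinearOrder {u : T // w ⋖ u}

variable {T}

/-- The labelling `ℓ` numbers the leaves from left to right: whenever `u` is a child of `w` to the
left of the child `v` of `w`, every leaf above `u` gets a smaller label than every leaf
above `v`. -/
def PlaneEmbedding.IsLeftToRight (e : PlaneEmbedding T) {n : ℕ} (ℓ : Leaf T ≃ Fin n) : Prop :=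
  ∀ (w : T) (u v : {u : T // w ⋖ u}), (e.childOrder w).lt u v →
    ∀ a b : Leaf T, u.1 ≤ a.1 → v.1 ≤ b.1 → ℓ a < ℓ b

variable {n : ℕ} (ℓ : Leaf T ≃ Fin n)

open Classical in
/-- The interval of `x`: the set of labels of the leaves `z ≥ x`. -/
noncomputable def interval (x : T) : Finset (Fin n) :=
  Finset.univ.filter fun i => x ≤ (ℓ.symm i).1

/-- The branch `B_I`: all vertices with interval `I`. -/
def branch (I : Finset (Fin n)) : Set T := {x | interval ℓ x = I}

/-- `β_I = #B_I`. -/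
noncomputable def beta (I : Finset (Fin n)) : ℕ := (branch ℓ I).ncard

/-- The family `𝓘(T)` of all pairs `(I, β_I)` with `I` the interval of a vertex. -/
def intervalFamily : Set (Finset (Fin n) × ℕ) :=
  Set.range fun x : T => (interval ℓ x, beta ℓ (interval ℓ x))

/-- An `𝓘(T)`-partition of `I`: all blocks come from `𝓘(T)`. Partitions are ordered by refinement
(finer is smaller), which is the order of `Finpartition`. -/
def IsFamilyPartition {I : Finset (Fin n)} (p : Finpartition I) : Prop :=
  ∀ J ∈ p.parts, ∃ b, (J, b) ∈ intervalFamily ℓ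

end Trees

/-! ### Tiles on a cylinder -/

section Tilings

inductive Color
  | black
  | yellow

/-- A coloured tile on the cylinder with rows `Fin n` and columns `ZMod N`. It covers the given
rows in the `width` consecutive columns `start, start + 1, …`. -/
@[ext]
structure Tile (n N : ℕ) where
  color : Color
  rows : Finset (Fin n)
  start : ZMod N
  width : ℕ

variable {n N : ℕ}

/-- The tile covers the cell in row `i` and column `c`. -/
def Tile.Covers (t : Tile n N) (i : Fin n) (c : ZMod N) : Prop :=
  i ∈ t.rows ∧ ∃ j < t.width, t.start + (j : ZMod N) = c

/-- The column immediately after the last column of the tile. -/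
def Tile.next (t : Tile n N) : ZMod N := t.start + (t.width : ZMod N)

/-- Rotation of a tile by `k` columns. -/
def Tile.rotate (k : ZMod N) (t : Tile n N) : Tile n N := { t with start := t.start + k }

/-- A set of tiles placed on a cylinder with `n` rows and some number of columns. -/
structure Arrangement (n : ℕ) where
  columns : ℕ
  tiles : Set (Tile n columns)

/-- Two arrangements differ by a rotation of the cylinder. -/
inductive Arrangement.Rotated : Arrangement n → Arrangement n → Prop
  | intro (N : ℕ) (S : Set (Tile n N)) (k : ZMod N) :
      Arrangement.Rotated ⟨N, S⟩ ⟨N, Tile.rotate k '' S⟩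

instance Arrangement.setoid (n : ℕ) : Setoid (Arrangement n) where
  r := Arrangement.Rotated
  iseqv :=
    { refl := by
        rintro ⟨N, S⟩
        have h := Arrangement.Rotated.intro N S 0
        have h0 : Tile.rotate (n := n) (0 : ZMod N) = id := by
          funext t; simp [Tile.rotate]
        rwa [h0, Set.image_id] at h
      symm := by
        rintro _ _ ⟨N, S, k⟩
        have h := Arrangement.Rotated.intro N (Tile.rotate k '' S) (-k)
        have h0 : Tile.rotate (n := n) (-k) ∘ Tile.rotate k = id := by
          funext t; simp [Tile.rotate]
        rwa [← Set.image_comp, h0, Set.image_id] at h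
      trans := by
        rintro _ _ _ ⟨N, S, k⟩ ⟨_, _, k'⟩
        have h := Arrangement.Rotated.intro N S (k + k')
        have h0 : Tile.rotate (n := n) (k + k') = Tile.rotate k' ∘ Tile.rotate k := by
          funext t; simp [Tile.rotate, add_assoc]
        rwa [h0, Set.image_comp] at h }

/-- Arrangements of tiles on a cylinder without marked starting column. -/
abbrev CylArrangement (n : ℕ) : Type := Quotient (Arrangement.setoid n)

/-- The tiles do not overlap themselves and cover every cell of the cylinder exactly once. -/
structure Arrangement.IsTiling (a : Arrangement n) : Prop where
  columns_pos : 0 < a.columns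
  width_le : ∀ t ∈ a.tiles, t.width ≤ a.columns
  existsUnique : ∀ (i : Fin n) (c : ZMod a.columns), ∃! t, t ∈ a.tiles ∧ t.Covers i c

/-- The arrangement is not a repetition of a shorter one: no nontrivial rotation fixes it. -/
def Arrangement.IsPrimitive (a : Arrangement n) : Prop :=
  ∀ k : ZMod a.columns, Tile.rotate k '' a.tiles = a.tiles → k = 0

/-- A black tile with row set `I` starts in column `c`. -/
def Arrangement.BlackStartsAt (a : Arrangement n) (I : Finset (Fin n)) (c : ZMod a.columns) :
    Prop :=
  ∃ t ∈ a.tiles, t.color = Color.black ∧ t.rows = I ∧ t.start = c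

/-- The cell in row `i` and column `c` is covered by a yellow tile. -/
def Arrangement.YellowAt (a : Arrangement n) (i : Fin n) (c : ZMod a.columns) : Prop :=
  ∃ t ∈ a.tiles, t.color = Color.yellow ∧ t.Covers i c

/-- `J` is a maximal interval of yellow tiles in column `c`. -/
def Arrangement.IsMaxYellow (a : Arrangement n) (J : Finset (Fin n)) (c : ZMod a.columns) :
    Prop :=
  Maximal (fun K : Finset (Fin n) =>
    (∃ i j, i ≤ j ∧ K = Finset.Icc i j) ∧ ∀ i ∈ K, a.YellowAt i c) J

variable {T : Type*} [PartialOrder T] (ℓ : Leaf T ≃ Fin n)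

/-- `𝓘(T)`-tilings: tilings of a cylinder by `I × β_I` black tiles and `1 × 1` yellow tiles
subject to the two succession rules. -/
structure IsFamilyTiling (a : Arrangement n) : Prop where
  isTiling : a.IsTiling
  black_shape : ∀ t ∈ a.tiles, t.color = Color.black → (t.rows, t.width) ∈ intervalFamily ℓ
  yellow_shape : ∀ t ∈ a.tiles, t.color = Color.yellow → t.rows.card = 1 ∧ t.width = 1
  t1_one : ∀ t ∈ a.tiles, t.color = Color.black → t.rows.card = 1 →
    ∀ i ∈ t.rows, a.YellowAt i t.next
  t1_two : ∀ t ∈ a.tiles, t.color = Color.black → 2 ≤ t.rows.card →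
    ∃ p : Finpartition t.rows,
      Maximal (fun q : Finpartition t.rows => IsFamilyPartition ℓ q ∧ q.parts ≠ {t.rows}) p ∧
      ∀ J ∈ p.parts, a.BlackStartsAt J t.next
  t2 : ∀ (c : ZMod a.columns) (J : Finset (Fin n)), a.IsMaxYellow J c →
    ∃ p : Finpartition J,
      Maximal (fun q : Finpartition J => IsFamilyPartition ℓ q) p ∧
      ∀ K ∈ p.parts, a.BlackStartsAt K (c + 1)

/-! ### The tiling of an orbit -/

/-- The rows indexed by `I` are covered by a black tile in the column of the antichain `A`. -/
def BlackIn (A : Antichains T) (I : Finset (Fin n)) : Prop := ∃ x ∈ A.1, interval ℓ x = I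

/-- The row `i` is left yellow in the column of the antichain `A`. -/
def YellowIn (A : Antichains T) (i : Fin n) : Prop := ∀ x ∈ A.1, i ∉ interval ℓ x

/-- The tiles obtained by pasting the columns of a cyclic sequence of antichains. Black tiles from
the same interval in consecutive columns are combined, so the black tiles with row set `I` are the
maximal runs of columns in which `I` is black. -/
def pastedTiles (A : ZMod N → Antichains T) : Set (Tile n N) :=
  {t | (t.color = Color.black ∧ 0 < t.width ∧
          (∀ j < t.width, BlackIn ℓ (A (t.start + (j : ZMod N))) t.rows) ∧
          ¬ BlackIn ℓ (A (t.start - 1)) t.rows ∧ ¬ BlackIn ℓ (A t.next) t.rows) ∨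
       (t.color = Color.yellow ∧ t.width = 1 ∧ ∃ i, t.rows = {i} ∧ YellowIn ℓ (A t.start) i)}

theorem pastedTiles_shift (A : ZMod N → Antichains T) (k : ZMod N) :
    pastedTiles ℓ (fun c => A (c + k)) = Tile.rotate (-k) '' pastedTiles ℓ A := by
  ext t
  constructor
  · intro h
    refine ⟨t.rotate k, ?_, by simp [Tile.rotate]⟩
    simp only [pastedTiles, Set.mem_ofPred_eq, Tile.next, Tile.rotate] at h ⊢
    have e1 : ∀ x : ZMod N, t.start + k + x = t.start + x + k := fun x => by ring
    have e2 : t.start + k - 1 = t.start - 1 + k := by ring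
    simpa only [e1, e2] using h
  · rintro ⟨t, h, rfl⟩
    simp only [pastedTiles, Set.mem_ofPred_eq, Tile.next, Tile.rotate] at h ⊢
    have e1 : ∀ x : ZMod N, t.start + -k + x + k = t.start + x := fun x => by ring
    have e2 : t.start + -k - 1 + k = t.start - 1 := by ring
    have e3 : t.start + -k + k = t.start := by ring
    simpa only [e1, e2, e3] using h

variable [Finite T]

/-- The tiling of the orbit of `A`, with the column of `A` as column `0`. The number of columns is
the size of the orbit, and column `c` is the one of `ρ ^ c (A)`. -/
noncomputable def tilingFrom (A : Antichains T) : Arrangement n where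
  columns := Function.minimalPeriod (rowmotion T) A
  tiles := pastedTiles ℓ fun c => (rowmotion T)^[c.val] A

theorem tilingFrom_rotated (A B : Antichains T) (h : (rowmotion T).SameCycle A B) :
    Arrangement.Rotated (tilingFrom ℓ A) (tilingFrom ℓ B) := by
  obtain ⟨k, -, rfl⟩ := h.exists_pow_eq'
  rw [← Equiv.Perm.iterate_eq_pow]
  have hA : A ∈ Function.periodicPts (rowmotion T) :=
    (rowmotion T).injective.mem_periodicPts A
  have hN := Function.minimalPeriod_apply_iterate hA k
  have hpos := Function.minimalPeriod_pos_of_mem_periodicPts hA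
  have hiter := fun m => Function.iterate_mod_minimalPeriod_eq (f := rowmotion T) (x := A) (n := m)
  unfold tilingFrom
  rw [hN]
  generalize Function.minimalPeriod (rowmotion T) A = N at hpos hiter
  have : NeZero N := ⟨hpos.ne'⟩
  have hcol : (fun c : ZMod N => (rowmotion T)^[c.val] ((rowmotion T)^[k] A)) =
      fun c : ZMod N => (rowmotion T)^[(c + (k : ZMod N)).val] A := by
    funext c
    rw [← Function.iterate_add_apply, ZMod.val_add, ZMod.val_natCast, hiter,
      Function.iterate_add_apply, Function.iterate_add_apply, hiter]
  rw [hcol, pastedTiles_shift ℓ (fun c : ZMod N => (rowmotion T)^[c.val] A)]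
  exact Arrangement.Rotated.intro _ _ _

/-- The map `𝒪 ↦ τ(𝒪)` from rowmotion orbits to arrangements of tiles on a cylinder. -/
noncomputable def tau : Orbits T → CylArrangement n :=
  Quotient.lift (fun A => (Quotient.mk _ (tilingFrom ℓ A) : CylArrangement n))
    fun A B h => Quotient.sound (tilingFrom_rotated ℓ A B h)

end Tilings

end TreeRowmotion

/-! In a rooted tree the elements below a given vertex form a chain (`LowerChain`). Hence intervals
are laminar, every branch is a chain, and an antichain has at most one vertex over each row. A
column of an orbit is thus the same data as a choice, row by row, of a vertex or of yellow.

Rowmotion is local in this picture. A vertex of `A` is replaced by its children. So inside a branch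
the antichain climbs one vertex per step, and from the top of the branch of `I` it passes to the
bottoms of the branches of the maximal proper subintervals of `I`, or to yellow if `I` is a single
leaf. Over yellow rows the new vertices are the lowest ones whose whole interval is yellow; since
intervals are convex, these are the branch bottoms of the maximal intervals contained in a maximal
yellow run. These are rules (t1) and (t2), and a black run over `I` starts at the bottom of its
branch and lasts exactly `β_I` columns (`LowerChain.mem_pastedTiles_black`). So orbits give tilings.

Conversely, the `j`-th column of a black tile over `I` is read as the `j`-th vertex of the branch of
`I`. Because of laminarity a maximal partition is unique, so (t1) and (t2) determine the next
column, and they determine it as rowmotion does (`IsFamilyTiling.row_succ`). The two constructions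
are inverse on cyclic sequences of antichains. Primitivity of the tiling says that the number of
columns is the minimal period, and rotations correspond to the choice of a starting antichain in the
orbit. -/

namespace TreeRowmotion

/-! ### Elements below a common element of a rooted tree -/

/-- Elements with a common upper bound are comparable. -/
def LowerChain (T : Type*) [PartialOrder T] : Prop :=
  ∀ ⦃x y z : T⦄, x ≤ z → y ≤ z → x ≤ y ∨ y ≤ x

section Tree

variable {T : Type*} [PartialOrder T] [Finite T]

theorem exists_le_covBy {x z : T} (h : x < z) : ∃ p, x ≤ p ∧ p ⋖ z := by
  obtain ⟨p, hp, hmax⟩ := (Set.toFinite {y | x ≤ y ∧ y < z}).exists_maximal ⟨x, le_rfl, h⟩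
  refine ⟨p, hp.1, hp.2, fun y hpy hyz => ?_⟩
  exact (hmax ⟨hp.1.trans hpy.le, hyz⟩ hpy.le).not_gt hpy

theorem exists_covBy_le' {x z : T} (h : x < z) : ∃ p, x ⋖ p ∧ p ≤ z := by
  obtain ⟨p, hp, hmin⟩ := (Set.toFinite {y | x < y ∧ y ≤ z}).exists_minimal ⟨z, h, le_rfl⟩
  refine ⟨p, ⟨hp.1, fun y hxy hyp => ?_⟩, hp.2⟩
  exact (hmin ⟨hxy, hyp.le.trans hp.2⟩ hyp.le).not_gt hyp

theorem IsRootedTree.exists_bot (hT : IsRootedTree T) : ∃ r : T, ∀ x, r ≤ x := by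
  obtain ⟨r, -, hu⟩ := hT.existsUnique_root
  refine ⟨r, fun x => ?_⟩
  obtain ⟨m, hmx, hm⟩ := (Set.toFinite (Set.univ : Set T)).exists_le_minimal (Set.mem_univ x)
  have : m = r := hu m fun y hy => hm.2 (Set.mem_univ y) hy
  exact this ▸ hmx

theorem exists_isPath_of_bot {r : T} (hr : ∀ x, r ≤ x) (x : T) :
    ∃ w : (SimpleGraph.hasse T).Walk r x, w.IsPath ∧ ∀ v ∈ w.support, v ≤ x := by
  induction x using (wellFounded_lt (α := T)).induction with
  | _ x ih =>
    rcases (hr x).eq_or_lt with rfl | hlt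
    · exact ⟨.nil, by simp, by simp⟩
    · obtain ⟨p, -, hp⟩ := exists_le_covBy hlt
      obtain ⟨w, hw, hle⟩ := ih p hp.lt
      have hadj : (SimpleGraph.hasse T).Adj p x := Or.inl hp
      refine ⟨w.concat hadj, hw.concat (fun h => (hle x h).not_gt hp.lt) _, ?_⟩
      intro v hv
      rw [SimpleGraph.Walk.support_concat, List.mem_append, List.mem_singleton] at hv
      rcases hv with hv | rfl
      · exact (hle v hv).trans hp.le
      · exact le_rfl

/-- Each lower cover of `z` extends a path from the root, staying below that cover, to a path ending
at `z`; a tree has only one such path, so its penultimate vertices agree. -/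
theorem IsRootedTree.covBy_unique (hT : IsRootedTree T) {p q z : T} (hp : p ⋖ z) (hq : q ⋖ z) :
    p = q := by
  obtain ⟨r, hr⟩ := hT.exists_bot
  obtain ⟨w, hw, hwle⟩ := exists_isPath_of_bot hr p
  obtain ⟨w', hw', hwle'⟩ := exists_isPath_of_bot hr q
  have h1 := hw.concat (fun h => (hwle z h).not_gt hp.lt)
    (show (SimpleGraph.hasse T).Adj p z from Or.inl hp)
  have h2 := hw'.concat (fun h => (hwle' z h).not_gt hq.lt)
    (show (SimpleGraph.hasse T).Adj q z from Or.inl hq)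
  have h3 := (hT.isTree.isAcyclic.subsingleton_path r z).elim ⟨_, h1⟩ ⟨_, h2⟩
  exact (SimpleGraph.Walk.concat_inj (Subtype.ext_iff.1 h3)).1

theorem IsRootedTree.lowerChain (hT : IsRootedTree T) : LowerChain T := by
  intro x y z
  induction z using (wellFounded_lt (α := T)).induction with
  | _ z ih =>
    intro hx hy
    rcases hx.eq_or_lt with rfl | hx
    · exact Or.inr hy
    rcases hy.eq_or_lt with rfl | hy
    · exact Or.inl hx.le
    obtain ⟨p, hxp, hp⟩ := exists_le_covBy hx
    obtain ⟨q, hyq, hq⟩ := exists_le_covBy hy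
    obtain rfl := hT.covBy_unique hp hq
    exact ih p hp.lt hxp hyq

end Tree

theorem LowerChain.le_of_lt_covBy {T : Type*} [PartialOrder T] (hF : LowerChain T) {p x y : T}
    (hp : p ⋖ x) (hy : y < x) : y ≤ p := by
  rcases hF hy.le hp.le with h | h
  · exact h
  · rcases h.eq_or_lt with h | h
    · exact h.ge
    · exact absurd hy (hp.2 h)

/-! ### Intervals -/

section Intervals

variable {T : Type*} [PartialOrder T] {n : ℕ} (ℓ : Leaf T ≃ Fin n)

theorem mem_interval {x : T} {i : Fin n} : i ∈ interval ℓ x ↔ x ≤ (ℓ.symm i).1 := by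
  simp [interval]

theorem interval_anti {x y : T} (h : x ≤ y) : interval ℓ y ⊆ interval ℓ x := fun _ hi =>
  (mem_interval ℓ).2 (h.trans ((mem_interval ℓ).1 hi))

theorem LowerChain.comparable_of_mem_interval (hF : LowerChain T) {x y : T} {i : Fin n}
    (hx : i ∈ interval ℓ x) (hy : i ∈ interval ℓ y) : x ≤ y ∨ y ≤ x :=
  hF ((mem_interval ℓ).1 hx) ((mem_interval ℓ).1 hy)

theorem interval_leaf (i : Fin n) : interval ℓ (ℓ.symm i).1 = {i} := by
  ext j
  rw [mem_interval, Finset.mem_singleton]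
  constructor
  · intro h
    have := (ℓ.symm i).2.eq_of_le h
    exact (ℓ.symm.injective (Subtype.ext this)).symm
  · rintro rfl
    exact le_rfl

variable [Finite T]

theorem interval_nonempty (x : T) : (interval ℓ x).Nonempty := by
  obtain ⟨m, hm, hmax⟩ := (Set.toFinite (Set.univ : Set T)).exists_le_maximal (Set.mem_univ x)
  refine ⟨ℓ ⟨m, fun y hy => hmax.2 (Set.mem_univ y) hy⟩, ?_⟩
  rw [mem_interval, Equiv.symm_apply_apply]
  exact hm

theorem LowerChain.lt_of_interval_ssubset (hF : LowerChain T) {x y : T}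
    (h : interval ℓ y ⊂ interval ℓ x) : x < y := by
  obtain ⟨i, hi⟩ := interval_nonempty ℓ y
  rcases hF.comparable_of_mem_interval ℓ (h.1 hi) hi with h' | h'
  · exact lt_of_le_of_ne h' fun e => h.ne (e ▸ rfl)
  · exact absurd (interval_anti ℓ h') h.2

theorem LowerChain.comparable_of_interval_eq (hF : LowerChain T) {x y : T}
    (h : interval ℓ x = interval ℓ y) : x ≤ y ∨ y ≤ x := by
  obtain ⟨i, hi⟩ := interval_nonempty ℓ x
  exact hF.comparable_of_mem_interval ℓ hi (h ▸ hi)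

/-- In a plane embedding with leaves numbered from left to right, the set of leaves above a vertex
is convex. -/
theorem ordConnected_interval (hT : IsRootedTree T) (e : PlaneEmbedding T)
    (hℓ : e.IsLeftToRight ℓ) (x : T) : (interval ℓ x : Set (Fin n)).OrdConnected := by
  have hF := hT.lowerChain
  refine ⟨fun i hi k hk j hj => ?_⟩
  by_contra hxj
  rw [Finset.mem_coe, mem_interval] at hi hk hxj
  obtain ⟨r, hr⟩ := hT.exists_bot
  -- At `w` the paths to `x` and to leaf `j` separate into distinct children `u` and `v`. If `u` is
  -- left of `v`, then `k` precedes `j`; otherwise `j` precedes `i`.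
  obtain ⟨w, hw, hmax⟩ := (Set.toFinite {y | y ≤ x ∧ y ≤ (ℓ.symm j).1}).exists_maximal
    ⟨r, hr _, hr _⟩
  have hwx : w < x := lt_of_le_of_ne hw.1 fun h => hxj (h ▸ hw.2)
  have hwj : w < (ℓ.symm j).1 := lt_of_le_of_ne hw.2 fun h =>
    hxj ((ℓ.symm j).2 (h ▸ hw.1))
  obtain ⟨u, hu, hux⟩ := exists_covBy_le' hwx
  obtain ⟨v, hv, hvj⟩ := exists_covBy_le' hwj
  have huv : u ≠ v := by
    rintro rfl
    exact (hmax ⟨hux, hvj⟩ hu.le).not_gt hu.lt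
  have hne : (⟨u, hu⟩ : {u : T // w ⋖ u}) ≠ ⟨v, hv⟩ := fun h => huv (congrArg Subtype.val h)
  let := e.childOrder w
  rcases lt_or_gt_of_ne hne with h | h
  · have := hℓ w _ _ h (ℓ.symm k) (ℓ.symm j) (hux.trans hk) hvj
    simp only [Equiv.apply_symm_apply] at this
    exact hj.2.not_gt this
  · have := hℓ w _ _ h (ℓ.symm j) (ℓ.symm i) hvj (hux.trans hi)
    simp only [Equiv.apply_symm_apply] at this
    exact hj.1.not_gt this

end Intervals

/-! ### The greatest partition into blocks of a laminar family -/

/-- By laminarity the maximal members of `G` are pairwise disjoint, and they cover `J`. Any block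
taken from `G` lies in one of them, so every other partition refines this one. -/
theorem exists_greatest_finpartition {α : Type*} [Fintype α] [DecidableEq α] (J : Finset α)
    (G : Finset α → Prop) (hsub : ∀ K, G K → K ⊆ J) (hne : ∀ K, G K → K.Nonempty)
    (hlam : ∀ K L, G K → G L → ∀ i ∈ K, i ∈ L → K ⊆ L ∨ L ⊆ K)
    (hcov : ∀ i ∈ J, ∃ K, G K ∧ i ∈ K) :
    ∃ p : Finpartition J, (∀ K, K ∈ p.parts ↔ Maximal G K) ∧
      ∀ q : Finpartition J, (∀ K ∈ q.parts, G K) → q ≤ p := by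
  classical
  have hext : ∀ K, G K → ∃ L, K ⊆ L ∧ Maximal G L := fun K hK =>
    (Set.toFinite {L | G L}).exists_le_maximal hK
  have hmem : ∀ K, K ∈ (Finset.univ.filter fun K => Maximal G K) ↔ Maximal G K := by simp
  refine ⟨⟨Finset.univ.filter fun K => Maximal G K, ?_, ?_, ?_⟩, hmem, ?_⟩
  · rw [Finset.supIndep_iff_pairwiseDisjoint]
    intro K hK L hL hKL
    have hK := (hmem K).1 hK
    have hL := (hmem L).1 hL
    refine Finset.disjoint_left.2 fun i hi hi' => hKL ?_
    rcases hlam K L hK.prop hL.prop i hi hi' with h | h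
    · exact hK.eq_of_le hL.prop h
    · exact (hL.eq_of_le hK.prop h).symm
  · ext i
    rw [Finset.mem_sup]
    constructor
    · rintro ⟨K, hK, hi⟩
      exact hsub K ((hmem K).1 hK).prop hi
    · intro hi
      obtain ⟨K, hK, hiK⟩ := hcov i hi
      obtain ⟨L, hKL, hL⟩ := hext K hK
      exact ⟨L, (hmem L).2 hL, hKL hiK⟩
  · intro h
    have := hne _ ((hmem _).1 h).prop
    exact this.ne_empty rfl
  · intro q hq K hK
    obtain ⟨L, hKL, hL⟩ := hext K (hq K hK)
    exact ⟨L, (hmem L).2 hL, hKL⟩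

theorem exists_maximal_finpartition {α : Type*} [Fintype α] [DecidableEq α] (J : Finset α)
    (G : Finset α → Prop) (hsub : ∀ K, G K → K ⊆ J) (hne : ∀ K, G K → K.Nonempty)
    (hlam : ∀ K L, G K → G L → ∀ i ∈ K, i ∈ L → K ⊆ L ∨ L ⊆ K)
    (hcov : ∀ i ∈ J, ∃ K, G K ∧ i ∈ K) :
    ∃ p : Finpartition J, Maximal (fun q : Finpartition J => ∀ K ∈ q.parts, G K) p := by
  obtain ⟨p, hp, hmax⟩ := exists_greatest_finpartition J G hsub hne hlam hcov
  exact ⟨p, fun K hK => ((hp K).1 hK).prop, fun q hq _ => hmax q hq⟩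

/-- Since a greatest partition exists, a maximal one is equal to it. This is what makes the
existential rules (t1) and (t2) deterministic. -/
theorem maximal_of_mem_maximal_finpartition {α : Type*} [Fintype α] [DecidableEq α]
    {J : Finset α} {G : Finset α → Prop} (hsub : ∀ K, G K → K ⊆ J)
    (hne : ∀ K, G K → K.Nonempty)
    (hlam : ∀ K L, G K → G L → ∀ i ∈ K, i ∈ L → K ⊆ L ∨ L ⊆ K)
    (hcov : ∀ i ∈ J, ∃ K, G K ∧ i ∈ K) {p : Finpartition J}
    (hp : Maximal (fun q : Finpartition J => ∀ K ∈ q.parts, G K) p) {K : Finset α}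
    (hK : K ∈ p.parts) : Maximal G K := by
  obtain ⟨q, hq, hmax⟩ := exists_greatest_finpartition J G hsub hne hlam hcov
  have h : p = q := hp.eq_of_le (fun K hK => ((hq K).1 hK).prop) (hmax p hp.prop)
  exact (hq K).1 (h ▸ hK)

/-! ### Maximal partitions into intervals -/

section FamilyPartitions

variable {T : Type*} [PartialOrder T] {n : ℕ} (ℓ : Leaf T ≃ Fin n)

/-- `K` is the interval of some vertex. -/
def IsInterval (K : Finset (Fin n)) : Prop := ∃ x : T, interval ℓ x = K

theorem exists_mem_intervalFamily_iff {K : Finset (Fin n)} :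
    (∃ b, (K, b) ∈ intervalFamily ℓ) ↔ IsInterval ℓ K := by
  constructor
  · rintro ⟨b, x, hx⟩
    exact ⟨x, congrArg Prod.fst hx⟩
  · rintro ⟨x, rfl⟩
    exact ⟨_, x, rfl⟩

theorem isFamilyPartition_iff {J : Finset (Fin n)} (q : Finpartition J) :
    IsFamilyPartition ℓ q ↔ ∀ K ∈ q.parts, IsInterval ℓ K ∧ K ⊆ J := by
  refine forall₂_congr fun K hK => ?_
  rw [exists_mem_intervalFamily_iff, and_iff_left]
  exact q.le hK

theorem isFamilyPartition_proper_iff {J : Finset (Fin n)} (hJ : J.Nonempty)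
    (q : Finpartition J) :
    (IsFamilyPartition ℓ q ∧ q.parts ≠ {J}) ↔ ∀ K ∈ q.parts, IsInterval ℓ K ∧ K ⊂ J := by
  rw [isFamilyPartition_iff]
  constructor
  · rintro ⟨h, hne⟩ K hK
    refine ⟨(h K hK).1, (h K hK).2.ssubset_of_ne ?_⟩
    rintro rfl
    refine hne (Finset.eq_singleton_iff_unique_mem.2 ⟨hK, fun L hL => ?_⟩)
    by_contra hLK
    obtain ⟨i, hi⟩ := q.nonempty_of_mem_parts hL
    exact Finset.disjoint_left.1 (q.disjoint hL hK hLK) hi (q.le hL hi)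
  · intro h
    refine ⟨fun K hK => ⟨(h K hK).1, (h K hK).2.1⟩, fun e => ?_⟩
    exact (h J (by simp [e])).2.ne rfl

variable {ℓ}

theorem LowerChain.laminar (hF : LowerChain T) {K L : Finset (Fin n)} {i : Fin n}
    (hK : IsInterval ℓ K) (hL : IsInterval ℓ L) (hiK : i ∈ K) (hiL : i ∈ L) :
    K ⊆ L ∨ L ⊆ K := by
  obtain ⟨x, rfl⟩ := hK
  obtain ⟨y, rfl⟩ := hL
  rcases hF.comparable_of_mem_interval ℓ hiK hiL with h | h
  · exact Or.inr (interval_anti ℓ h)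
  · exact Or.inl (interval_anti ℓ h)

variable [Finite T]

theorem IsInterval.nonempty {K : Finset (Fin n)} (h : IsInterval ℓ K) : K.Nonempty := by
  obtain ⟨x, rfl⟩ := h
  exact interval_nonempty ℓ x

theorem LowerChain.exists_maximal_familyPartition (hF : LowerChain T) (J : Finset (Fin n)) :
    ∃ p : Finpartition J, Maximal (fun q : Finpartition J => IsFamilyPartition ℓ q) p := by
  simp only [isFamilyPartition_iff]
  exact exists_maximal_finpartition J (fun K => IsInterval ℓ K ∧ K ⊆ J) (fun K h => h.2)
    (fun K h => h.1.nonempty) (fun _ _ hK hL _ => hF.laminar hK.1 hL.1)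
    (fun i hi => ⟨{i}, ⟨⟨_, interval_leaf ℓ i⟩, by simpa using hi⟩, by simp⟩)

theorem LowerChain.maximal_of_mem_familyPartition (hF : LowerChain T) {J : Finset (Fin n)}
    {p : Finpartition J} (hp : Maximal (fun q : Finpartition J => IsFamilyPartition ℓ q) p)
    {K : Finset (Fin n)} (hK : K ∈ p.parts) : Maximal (fun K => IsInterval ℓ K ∧ K ⊆ J) K := by
  simp only [isFamilyPartition_iff] at hp
  exact maximal_of_mem_maximal_finpartition (fun K h => h.2)
    (fun K h => h.1.nonempty) (fun _ _ hK hL _ => hF.laminar hK.1 hL.1)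
    (fun i hi => ⟨{i}, ⟨⟨_, interval_leaf ℓ i⟩, by simpa using hi⟩, by simp⟩) hp hK

theorem singleton_ssubset_of_two_le_card {J : Finset (Fin n)} (hJ : 2 ≤ J.card) {i : Fin n}
    (hi : i ∈ J) : {i} ⊂ J := by
  refine (Finset.singleton_subset_iff.2 hi).ssubset_of_ne ?_
  rintro rfl
  simp at hJ

theorem LowerChain.exists_maximal_proper_familyPartition (hF : LowerChain T)
    {J : Finset (Fin n)} (hJ : 2 ≤ J.card) :
    ∃ p : Finpartition J,
      Maximal (fun q : Finpartition J => IsFamilyPartition ℓ q ∧ q.parts ≠ {J}) p := by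
  simp only [isFamilyPartition_proper_iff ℓ (Finset.card_pos.1 (by omega : 0 < J.card))]
  exact exists_maximal_finpartition J (fun K => IsInterval ℓ K ∧ K ⊂ J) (fun K h => h.2.1)
    (fun K h => h.1.nonempty) (fun _ _ hK hL _ => hF.laminar hK.1 hL.1)
    (fun i hi => ⟨{i}, ⟨⟨_, interval_leaf ℓ i⟩, singleton_ssubset_of_two_le_card hJ hi⟩,
      by simp⟩)

theorem LowerChain.maximal_of_mem_proper_familyPartition (hF : LowerChain T)
    {J : Finset (Fin n)} (hJ : 2 ≤ J.card) {p : Finpartition J}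
    (hp : Maximal (fun q : Finpartition J => IsFamilyPartition ℓ q ∧ q.parts ≠ {J}) p)
    {K : Finset (Fin n)} (hK : K ∈ p.parts) : Maximal (fun K => IsInterval ℓ K ∧ K ⊂ J) K := by
  simp only [isFamilyPartition_proper_iff ℓ (Finset.card_pos.1 (by omega : 0 < J.card))] at hp
  exact maximal_of_mem_maximal_finpartition (fun K h => h.2.1)
    (fun K h => h.1.nonempty) (fun _ _ hK hL _ => hF.laminar hK.1 hL.1)
    (fun i hi => ⟨{i}, ⟨⟨_, interval_leaf ℓ i⟩, singleton_ssubset_of_two_le_card hJ hi⟩,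
      by simp⟩) hp hK

end FamilyPartitions

/-! ### Positions in a branch -/

section Branch

variable {T : Type*} [PartialOrder T] {n : ℕ} (ℓ : Leaf T ≃ Fin n)

/-- The number of elements below `x` in the branch of `x`. -/
noncomputable def branchRank (x : T) : ℕ := {y | y < x ∧ interval ℓ y = interval ℓ x}.ncard

/-- `x` is the lowest vertex of its branch. -/
def IsBranchMin (x : T) : Prop := ∀ y < x, interval ℓ y ≠ interval ℓ x

/-- `x` is the highest vertex of its branch. -/
def IsBranchMax (x : T) : Prop := ∀ y, x < y → interval ℓ y ≠ interval ℓ x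

variable {ℓ}

theorem interval_eq_of_between {x y z : T} (hxy : x ≤ y) (hyz : y ≤ z)
    (h : interval ℓ x = interval ℓ z) : interval ℓ y = interval ℓ x :=
  (interval_anti ℓ hxy).antisymm (h ▸ interval_anti ℓ hyz)

variable [Finite T]

theorem branchRank_eq_zero_iff {x : T} : branchRank ℓ x = 0 ↔ IsBranchMin ℓ x := by
  rw [branchRank, Set.ncard_eq_zero (Set.toFinite _), Set.eq_empty_iff_forall_notMem]
  exact ⟨fun h y hy e => h y ⟨hy, e⟩, fun h y hy => h y hy.1 hy.2⟩

theorem branchRank_lt_beta (x : T) : branchRank ℓ x < beta ℓ (interval ℓ x) := by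
  refine Set.ncard_lt_ncard ⟨fun y hy => hy.2, fun h => ?_⟩ (Set.toFinite _)
  exact (h (show x ∈ branch ℓ (interval ℓ x) from rfl)).1.false

theorem branchRank_lt {x y : T} (hxy : x < y) (h : interval ℓ x = interval ℓ y) :
    branchRank ℓ x < branchRank ℓ y := by
  refine Set.ncard_lt_ncard ⟨fun z hz => ⟨hz.1.trans hxy, hz.2.trans h⟩, fun hs => ?_⟩
    (Set.toFinite _)
  exact (hs (show x ∈ _ from ⟨hxy, h⟩)).1.false

theorem LowerChain.branchRank_inj (hF : LowerChain T) {x y : T}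
    (h : interval ℓ x = interval ℓ y) (hr : branchRank ℓ x = branchRank ℓ y) : x = y := by
  rcases hF.comparable_of_interval_eq ℓ h with h' | h'
  · exact h'.eq_or_lt.resolve_right fun hlt => (branchRank_lt hlt h).ne hr
  · exact (h'.eq_or_lt.resolve_right fun hlt => (branchRank_lt hlt h.symm).ne hr.symm).symm

theorem LowerChain.branchRank_add_one_eq_beta (hF : LowerChain T) {x : T}
    (h : IsBranchMax ℓ x) : branchRank ℓ x + 1 = beta ℓ (interval ℓ x) := by
  rw [branchRank, beta, ← Set.ncard_insert_of_notMem (fun h => h.1.false) (Set.toFinite _)]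
  congr 1
  ext y
  constructor
  · rintro (rfl | hy)
    · rfl
    · exact hy.2
  · intro hy
    rcases hF.comparable_of_interval_eq ℓ hy with h' | h'
    · exact h'.eq_or_lt.imp id fun hlt => ⟨hlt, hy⟩
    · exact Or.inl (h'.eq_or_lt.resolve_right fun hlt => h y hlt hy).symm

theorem LowerChain.branchRank_of_covBy (hF : LowerChain T) {x y : T} (hxy : x ⋖ y)
    (h : interval ℓ x = interval ℓ y) : branchRank ℓ y = branchRank ℓ x + 1 := by
  rw [branchRank, branchRank,
    ← Set.ncard_insert_of_notMem (fun h => h.1.false) (Set.toFinite _)]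
  congr 1
  ext z
  constructor
  · rintro ⟨hz, hz'⟩
    exact (hF.le_of_lt_covBy hxy hz).eq_or_lt.imp id fun hlt => ⟨hlt, hz'.trans h.symm⟩
  · rintro (rfl | hz)
    · exact ⟨hxy.lt, h⟩
    · exact ⟨hz.1.trans hxy.lt, hz.2.trans h⟩

theorem exists_covBy_of_not_isBranchMax {x : T} (h : ¬ IsBranchMax ℓ x) :
    ∃ y, x ⋖ y ∧ interval ℓ y = interval ℓ x := by
  unfold IsBranchMax at h
  push Not at h
  obtain ⟨z, hxz, hz⟩ := h
  obtain ⟨y, hy, hyz⟩ := exists_covBy_le' hxz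
  exact ⟨y, hy, interval_eq_of_between hy.le hyz hz.symm⟩

theorem exists_covBy_of_not_isBranchMin {x : T} (h : ¬ IsBranchMin ℓ x) :
    ∃ y, y ⋖ x ∧ interval ℓ y = interval ℓ x := by
  unfold IsBranchMin at h
  push Not at h
  obtain ⟨z, hzx, hz⟩ := h
  obtain ⟨y, hzy, hy⟩ := exists_le_covBy hzx
  exact ⟨y, hy, (interval_eq_of_between hzy hy.le hz).trans hz⟩

theorem IsInterval.exists_isBranchMin {K : Finset (Fin n)} (hK : IsInterval ℓ K) :
    ∃ x, interval ℓ x = K ∧ IsBranchMin ℓ x := by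
  obtain ⟨x, hx, hmin⟩ := (Set.toFinite {x | interval ℓ x = K}).exists_minimal hK
  exact ⟨x, hx, fun y hy h => (hmin (h.trans hx) hy.le).not_gt hy⟩

/-- Climbing the branch by covers from its bottom raises the rank by one each time, so every column
offset of a `β_K`-wide tile is the rank of a vertex. -/
theorem LowerChain.exists_branchRank_eq (hF : LowerChain T) {K : Finset (Fin n)} {j : ℕ}
    (hj : j < beta ℓ K) : ∃ x, interval ℓ x = K ∧ branchRank ℓ x = j := by
  induction j with
  | zero =>
    have hK : IsInterval ℓ K := (Set.ncard_pos (Set.toFinite _)).1 hj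
    obtain ⟨x, hx, hmin⟩ := hK.exists_isBranchMin
    exact ⟨x, hx, branchRank_eq_zero_iff.2 hmin⟩
  | succ j ih =>
    obtain ⟨x, rfl, hr⟩ := ih (by omega)
    have hx : ¬ IsBranchMax ℓ x := fun h => by
      have := hF.branchRank_add_one_eq_beta h
      omega
    obtain ⟨y, hxy, hy⟩ := exists_covBy_of_not_isBranchMax hx
    exact ⟨y, hy, by rw [hF.branchRank_of_covBy hxy hy.symm, hr]⟩

theorem IsInterval.beta_pos {K : Finset (Fin n)} (hK : IsInterval ℓ K) : 0 < beta ℓ K := by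
  obtain ⟨x, rfl⟩ := hK
  exact (Nat.zero_le _).trans_lt (branchRank_lt_beta x)

theorem isBranchMax_of_beta_le {x : T}
    (h : beta ℓ (interval ℓ x) ≤ branchRank ℓ x + 1) : IsBranchMax ℓ x := by
  intro y hxy hy
  have h1 := branchRank_lt hxy hy.symm
  have h2 := branchRank_lt_beta (ℓ := ℓ) y
  rw [hy] at h2
  omega

end Branch

/-! ### Rowmotion in terms of rows -/

section Rho

variable {T : Type*} [PartialOrder T] {n : ℕ} {ℓ : Leaf T ≃ Fin n} {A : Antichains T}

theorem mem_rho_iff {x : T} :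
    x ∈ (rho A).1 ↔ (∀ a ∈ A.1, ¬ x ≤ a) ∧ ∀ y < x, ∃ a ∈ A.1, y ≤ a := by
  change Minimal (fun y => y ∉ lowerClosure A.1) x ↔ _
  rw [minimal_iff_forall_lt]
  simp only [mem_lowerClosure, not_exists, not_and]
  simp

theorem LowerChain.eq_of_mem_interval (hF : LowerChain T) {x y : T} {i : Fin n}
    (hx : x ∈ A.1) (hy : y ∈ A.1) (hix : i ∈ interval ℓ x) (hiy : i ∈ interval ℓ y) : x = y := by
  rcases hF.comparable_of_mem_interval ℓ hix hiy with h | h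
  · exact A.2.eq hx hy h
  · exact (A.2.eq hy hx h).symm

theorem LowerChain.mem_rho_of_covBy (hF : LowerChain T) {p x : T} (hp : p ∈ A.1)
    (hpx : p ⋖ x) : x ∈ (rho A).1 := by
  refine mem_rho_iff.2 ⟨fun a ha hxa => ?_, fun y hy => ⟨p, hp, hF.le_of_lt_covBy hpx hy⟩⟩
  have := A.2.eq hp ha (hpx.le.trans hxa)
  exact (hxa.trans this.ge).not_gt hpx.lt

variable [Finite T]

/-- A vertex `y < x` with a nonyellow row is comparable to some `a ∈ A`; here `a ≤ y` would make the
rows of `x` black, so `y ≤ a`. -/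
theorem LowerChain.mem_rho_of_yellowIn (hF : LowerChain T) {x : T}
    (hx : ∀ i ∈ interval ℓ x, YellowIn ℓ A i)
    (hlt : ∀ y < x, ∃ i ∈ interval ℓ y, ¬ YellowIn ℓ A i) : x ∈ (rho A).1 := by
  refine mem_rho_iff.2 ⟨fun a ha hxa => ?_, fun y hy => ?_⟩
  · obtain ⟨i, hi⟩ := interval_nonempty ℓ a
    exact hx i (interval_anti ℓ hxa hi) a ha hi
  · obtain ⟨i, hi, hb⟩ := hlt y hy
    unfold YellowIn at hb
    push Not at hb
    obtain ⟨a, ha, hia⟩ := hb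
    refine ⟨a, ha, (hF.comparable_of_mem_interval ℓ hi hia).resolve_right fun h => ?_⟩
    obtain ⟨k, hk⟩ := interval_nonempty ℓ x
    exact hx k hk a ha (interval_anti ℓ (h.trans hy.le) hk)

/-- If some `z ∈ A` shares a row with `x`, then `z < x`. The parent of `x` lies above `z` and below
a member of `A`, and the antichain property makes it equal to `z`. -/
theorem LowerChain.covBy_or_yellowIn_of_mem_rho (hF : LowerChain T) {x : T}
    (hx : x ∈ (rho A).1) : (∃ p ∈ A.1, p ⋖ x) ∨ ∀ i ∈ interval ℓ x, YellowIn ℓ A i := by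
  rw [mem_rho_iff] at hx
  refine or_iff_not_imp_right.2 fun h => ?_
  unfold YellowIn at h
  push Not at h
  obtain ⟨i, hi, z, hz, hiz⟩ := h
  have hzx : z < x := by
    rcases hF.comparable_of_mem_interval ℓ hi hiz with h | h
    · exact absurd h (hx.1 z hz)
    · exact lt_of_le_of_ne h fun e => hx.1 z hz e.ge
  obtain ⟨p, hzp, hpx⟩ := exists_le_covBy hzx
  obtain ⟨a, ha, hpa⟩ := hx.2 p hpx.lt
  have : z = a := A.2.eq hz ha (hzp.trans hpa)
  exact ⟨z, hz, le_antisymm hzp (this ▸ hpa) ▸ hpx⟩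

/-- The lowest vertex of a maximal proper subinterval of `I` appears after the highest vertex of
the branch of `I`. -/
theorem LowerChain.mem_rho_of_maximal_proper (hF : LowerChain T) {x z : T} (hz : z ∈ A.1)
    (hzmax : IsBranchMax ℓ z)
    (hK : Maximal (fun K => IsInterval ℓ K ∧ K ⊂ interval ℓ z) (interval ℓ x))
    (hxmin : IsBranchMin ℓ x) : x ∈ (rho A).1 := by
  have hzx := hF.lt_of_interval_ssubset ℓ hK.prop.2
  refine hF.mem_rho_of_covBy hz ⟨hzx, fun y hzy hyx => ?_⟩
  have h1 : interval ℓ y ⊂ interval ℓ z :=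
    (interval_anti ℓ hzy.le).ssubset_of_ne (hzmax y hzy)
  exact hxmin y hyx (hK.eq_of_le ⟨⟨y, rfl⟩, h1⟩ (interval_anti ℓ hyx.le)).symm

/-- The lowest vertex of a maximal subinterval of a maximal yellow interval appears in the next
column. -/
theorem LowerChain.mem_rho_of_maximal_yellow (hF : LowerChain T)
    (hconv : ∀ x : T, (interval ℓ x : Set (Fin n)).OrdConnected) {J : Finset (Fin n)}
    (hJ : Maximal (fun K : Finset (Fin n) =>
      (∃ i j, i ≤ j ∧ K = Finset.Icc i j) ∧ ∀ i ∈ K, YellowIn ℓ A i) J) {x : T}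
    (hK : Maximal (fun K => IsInterval ℓ K ∧ K ⊆ J) (interval ℓ x))
    (hxmin : IsBranchMin ℓ x) : x ∈ (rho A).1 := by
  refine hF.mem_rho_of_yellowIn (ℓ := ℓ) (fun i hi => hJ.prop.2 i (hK.prop.2 hi)) fun y hy => ?_
  by_contra! hyel
  obtain ⟨k, hk⟩ := interval_nonempty ℓ x
  have hky := interval_anti ℓ hy.le hk
  have hkJ := hK.prop.2 hk
  -- This is where convexity enters: `interval ℓ y` is a yellow segment meeting the yellow segment
  -- `J`, so their hull is again a yellow segment, and maximality of `J` absorbs it.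
  have hsub : interval ℓ y ⊆ J := by
    obtain ⟨⟨i, j, hij, rfl⟩, hJy⟩ := hJ.prop
    have hmin := Finset.min'_mem _ (interval_nonempty ℓ y)
    have hmax := Finset.max'_mem _ (interval_nonempty ℓ y)
    have hle : ∀ l ∈ interval ℓ y, (interval ℓ y).min' (interval_nonempty ℓ y) ≤ l :=
      fun l hl => Finset.min'_le _ l hl
    have hge : ∀ l ∈ interval ℓ y, l ≤ (interval ℓ y).max' (interval_nonempty ℓ y) :=
      fun l hl => Finset.le_max' _ l hl
    generalize (interval ℓ y).min' (interval_nonempty ℓ y) = a at *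
    generalize (interval ℓ y).max' (interval_nonempty ℓ y) = b at *
    rw [Finset.mem_Icc] at hkJ
    have hak := hle k hky
    have hkb := hge k hky
    have hmem : ∀ l, a ≤ l → l ≤ b → l ∈ interval ℓ y := fun l h1 h2 =>
      (hconv y).out hmin hmax ⟨h1, h2⟩
    have hext : (∃ i' j', i' ≤ j' ∧ Finset.Icc (min i a) (max j b) = Finset.Icc i' j') ∧
        ∀ l ∈ Finset.Icc (min i a) (max j b), YellowIn ℓ A l := by
      refine ⟨⟨_, _, (min_le_left i a).trans (hij.trans (le_max_left j b)), rfl⟩, fun l hl => ?_⟩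
      rw [Finset.mem_Icc] at hl
      by_cases h1 : l ∈ Finset.Icc i j
      · exact hJy l h1
      · refine hyel l (hmem l ?_ ?_) <;> rw [Finset.mem_Icc] at h1 <;> grind
    have hEq := hJ.eq_of_le hext (Finset.Icc_subset_Icc (min_le_left _ _) (le_max_left _ _))
    intro l hl
    rw [hEq, Finset.mem_Icc]
    exact ⟨(min_le_right _ _).trans (hle l hl), (hge l hl).trans (le_max_right _ _)⟩
  exact hxmin y hy (hK.eq_of_le ⟨⟨y, rfl⟩, hsub⟩ (interval_anti ℓ hy.le)).symm

/-- A row is yellow after the highest vertex of a branch with a single leaf. -/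
theorem LowerChain.yellowIn_rho (hF : LowerChain T) {z : T} {i : Fin n} (hz : z ∈ A.1)
    (hzmax : IsBranchMax ℓ z) (hi : interval ℓ z = {i}) : YellowIn ℓ (rho A) i := by
  intro y hy hiy
  rw [mem_rho_iff] at hy
  rcases hF.comparable_of_mem_interval ℓ hiy (hi ▸ Finset.mem_singleton_self i) with h | h
  · exact hy.1 z hz h
  · have hne : y ≠ z := fun e => hy.1 z hz e.le
    refine hzmax y (lt_of_le_of_ne h hne.symm) ?_
    have := interval_anti ℓ h
    rw [hi] at this ⊢
    exact (Finset.subset_singleton_iff.1 this).resolve_left (interval_nonempty ℓ y).ne_empty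

/-- An interval is not black directly after the highest vertex of its branch. -/
theorem LowerChain.not_blackIn_rho (hF : LowerChain T) {z : T} (hz : z ∈ A.1)
    (hzmax : IsBranchMax ℓ z) : ¬ BlackIn ℓ (rho A) (interval ℓ z) := by
  rintro ⟨y, hy, hyz⟩
  rw [mem_rho_iff] at hy
  rcases hF.comparable_of_interval_eq ℓ hyz with h | h
  · exact hy.1 z hz h
  · exact hzmax y (lt_of_le_of_ne h fun e => hy.1 z hz e.ge) hyz

/-- An interval is not black directly before the lowest vertex of its branch. -/
theorem LowerChain.not_blackIn_of_mem_rho (hF : LowerChain T) {x : T} (hx : x ∈ (rho A).1)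
    (hxmin : IsBranchMin ℓ x) : ¬ BlackIn ℓ A (interval ℓ x) := by
  rintro ⟨y, hy, hyx⟩
  rw [mem_rho_iff] at hx
  rcases hF.comparable_of_interval_eq ℓ hyx with h | h
  · exact hxmin y (lt_of_le_of_ne h fun e => hx.1 y hy e.ge) hyx
  · exact hx.1 y hy h

/-- Backward determinism inside a branch: some `a ∈ A` lies above `p`, so a row of `p`, hence of
`x`, is not yellow, and `x` can only have come from its parent. -/
theorem LowerChain.mem_of_covBy_of_mem_rho (hF : LowerChain T) {p x : T}
    (hx : x ∈ (rho A).1) (hpx : p ⋖ x) (h : interval ℓ p = interval ℓ x) : p ∈ A.1 := by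
  obtain ⟨a, ha, hpa⟩ := (mem_rho_iff.1 hx).2 p hpx.lt
  rcases hF.covBy_or_yellowIn_of_mem_rho (ℓ := ℓ) hx with ⟨q, hq, hqx⟩ | hy
  · have h1 := hF.le_of_lt_covBy hqx hpx.lt
    have h2 := hF.le_of_lt_covBy hpx hqx.lt
    exact le_antisymm h1 h2 ▸ hq
  · obtain ⟨i, hi⟩ := interval_nonempty ℓ a
    exact absurd hi (hy i (h ▸ interval_anti ℓ hpa hi) a ha)

end Rho

/-! ### Tilings pasted from cyclic rowmotion sequences -/

section Pasted

variable {T : Type*} [PartialOrder T] {n N : ℕ} {ℓ : Leaf T ≃ Fin n}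
  {A : ZMod N → Antichains T}

theorem mem_pastedTiles_yellow {t : Tile n N} (ht : t.color = Color.yellow) :
    t ∈ pastedTiles ℓ A ↔ t.width = 1 ∧ ∃ i, t.rows = {i} ∧ YellowIn ℓ (A t.start) i := by
  simp [pastedTiles, ht]

theorem width_le_of_mem_pastedTiles (hN : 0 < N) {t : Tile n N} (ht : t ∈ pastedTiles ℓ A) :
    t.width ≤ N := by
  rcases ht with ⟨-, -, hb, hbefore, -⟩ | ⟨-, hw, -⟩
  · by_contra! hlt
    -- In `ZMod N` the column before the start is the one at offset `N - 1`, which a tile wider than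
    -- `N` would already make black.
    refine hbefore ?_
    have := hb (N - 1) (by omega)
    rwa [Nat.cast_sub hN, ZMod.natCast_self, Nat.cast_one, zero_sub, ← sub_eq_add_neg] at this
  · omega

variable [Finite T]

theorem LowerChain.exists_mem_add (hF : LowerChain T) (hA : ∀ c, A (c + 1) = rho (A c))
    {c : ZMod N} {x : T} (hx : x ∈ (A c).1) {j : ℕ}
    (hj : branchRank ℓ x + j < beta ℓ (interval ℓ x)) :
    ∃ y ∈ (A (c + j)).1, interval ℓ y = interval ℓ x ∧ branchRank ℓ y = branchRank ℓ x + j := by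
  induction j with
  | zero => exact ⟨x, by simpa using hx, rfl, rfl⟩
  | succ j ih =>
    obtain ⟨y, hy, hyx, hr⟩ := ih (by omega)
    have hmax : ¬ IsBranchMax ℓ y := fun h => by
      have := hF.branchRank_add_one_eq_beta h
      rw [hyx] at this
      omega
    obtain ⟨z, hyz, hz⟩ := exists_covBy_of_not_isBranchMax hmax
    refine ⟨z, ?_, hz.trans hyx, ?_⟩
    · rw [Nat.cast_add, Nat.cast_one, ← add_assoc, hA]
      exact hF.mem_rho_of_covBy hy hyz
    · rw [hF.branchRank_of_covBy hyz hz.symm, hr, add_assoc]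

theorem LowerChain.exists_mem_sub (hF : LowerChain T) (hA : ∀ c, A (c + 1) = rho (A c))
    {c : ZMod N} {x : T} (hx : x ∈ (A c).1) :
    ∃ y ∈ (A (c - branchRank ℓ x)).1, interval ℓ y = interval ℓ x ∧ branchRank ℓ y = 0 := by
  generalize hm : branchRank ℓ x = m
  induction m generalizing x c with
  | zero => exact ⟨x, by simpa using hx, rfl, hm⟩
  | succ m ih =>
    have hmin : ¬ IsBranchMin ℓ x := fun h => by
      have := branchRank_eq_zero_iff.2 h
      omega
    obtain ⟨p, hpx, hp⟩ := exists_covBy_of_not_isBranchMin hmin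
    have hr := hF.branchRank_of_covBy hpx hp
    have hc : A c = rho (A (c - 1)) := by rw [← hA, sub_add_cancel]
    rw [hc] at hx
    obtain ⟨y, hy, hyp, h0⟩ := ih (hF.mem_of_covBy_of_mem_rho hx hpx hp) (by omega)
    refine ⟨y, ?_, hyp.trans hp, h0⟩
    rwa [Nat.cast_add, Nat.cast_one, add_comm, ← sub_sub]

/-- A run cannot start higher in the branch, since the parent would make the preceding column black.
From the bottom it climbs one vertex per column and stops right after the top, which fixes its
width. -/
theorem LowerChain.mem_pastedTiles_black (hF : LowerChain T)
    (hA : ∀ c, A (c + 1) = rho (A c)) {t : Tile n N} (ht : t.color = Color.black) :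
    t ∈ pastedTiles ℓ A ↔
      ∃ x ∈ (A t.start).1, interval ℓ x = t.rows ∧ branchRank ℓ x = 0 ∧
        t.width = beta ℓ t.rows := by
  have hprev : ∀ c, A c = rho (A (c - 1)) := fun c => by rw [← hA, sub_add_cancel]
  have hafter : ∀ c x, x ∈ (A c).1 → branchRank ℓ x = 0 →
      ¬ BlackIn ℓ (A (c + beta ℓ (interval ℓ x))) (interval ℓ x) := by
    intro c x hx h0
    have hpos := IsInterval.beta_pos ⟨x, rfl⟩ (K := interval ℓ x)
    obtain ⟨y, hy, hyx, hr⟩ := hF.exists_mem_add (ℓ := ℓ) hA hx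
      (j := beta ℓ (interval ℓ x) - 1) (by omega)
    have hymax : IsBranchMax ℓ y := isBranchMax_of_beta_le (by rw [hyx]; omega)
    have := hF.not_blackIn_rho hy hymax
    rw [← hA, hyx] at this
    convert this using 3
    rw [add_assoc]
    congr 1
    rw [← Nat.cast_add_one, Nat.sub_add_cancel hpos]
  have hblack : ∀ c x, x ∈ (A c).1 → branchRank ℓ x = 0 → ∀ j < beta ℓ (interval ℓ x),
      BlackIn ℓ (A (c + j)) (interval ℓ x) := by
    intro c x hx h0 j hj
    obtain ⟨y, hy, hyx, -⟩ := hF.exists_mem_add (ℓ := ℓ) hA hx (j := j) (by omega)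
    exact ⟨y, hy, hyx⟩
  constructor
  · rintro (⟨-, hw, hb, hbefore, hnext⟩ | ⟨hy, -⟩)
    · obtain ⟨x, hx, hxr⟩ := hb 0 hw
      rw [Nat.cast_zero, add_zero] at hx
      have hmin : IsBranchMin ℓ x := by
        by_contra hmin
        obtain ⟨p, hpx, hp⟩ := exists_covBy_of_not_isBranchMin hmin
        rw [hprev] at hx
        exact hbefore ⟨p, hF.mem_of_covBy_of_mem_rho hx hpx hp, hp.trans hxr⟩
      have h0 := branchRank_eq_zero_iff.2 hmin
      refine ⟨x, hx, hxr, h0, ?_⟩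
      rcases lt_trichotomy t.width (beta ℓ t.rows) with h | h | h
      · exact absurd (hxr ▸ hblack _ x hx h0 t.width (hxr ▸ h)) hnext
      · exact h
      · exact absurd (hb _ h) (hxr ▸ hafter _ x hx h0)
    · rw [ht] at hy
      cases hy
  · rintro ⟨x, hx, hxr, h0, hw⟩
    refine Or.inl ⟨ht, ?_, ?_, ?_, ?_⟩
    · rw [hw]
      exact IsInterval.beta_pos ⟨x, hxr⟩
    · rw [hw, ← hxr]
      exact hblack _ x hx h0
    · rw [hprev] at hx
      rw [← hxr]
      exact hF.not_blackIn_of_mem_rho hx (branchRank_eq_zero_iff.1 h0)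
    · rw [Tile.next, hw, ← hxr]
      exact hafter _ x hx h0

/-- The sequence of antichains is determined by its tiling. -/
theorem LowerChain.pastedTiles_injective (hF : LowerChain T) {B : ZMod N → Antichains T}
    (hA : ∀ c, A (c + 1) = rho (A c)) (hB : ∀ c, B (c + 1) = rho (B c))
    (h : pastedTiles ℓ A = pastedTiles ℓ B) : A = B := by
  have key : ∀ A B : ZMod N → Antichains T, (∀ c, A (c + 1) = rho (A c)) →
      (∀ c, B (c + 1) = rho (B c)) → pastedTiles ℓ A = pastedTiles ℓ B →
      ∀ c, (A c).1 ⊆ (B c).1 := by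
    intro A B hA hB h c x hx
    obtain ⟨y, hy, hyx, h0⟩ := hF.exists_mem_sub (ℓ := ℓ) hA hx
    have ht : (⟨Color.black, interval ℓ x, c - branchRank ℓ x, beta ℓ (interval ℓ x)⟩ :
        Tile n N) ∈ pastedTiles ℓ A :=
      (hF.mem_pastedTiles_black hA rfl).2 ⟨y, hy, hyx, h0, rfl⟩
    rw [h, hF.mem_pastedTiles_black hB rfl] at ht
    obtain ⟨z, hz, hzx, hz0, -⟩ := ht
    have hlt := branchRank_lt_beta (ℓ := ℓ) x
    dsimp only at hz hzx
    obtain ⟨w, hw, hwz, hr⟩ := hF.exists_mem_add (ℓ := ℓ) hB hz (j := branchRank ℓ x)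
      (by rw [hzx]; omega)
    rw [sub_add_cancel] at hw
    have : w = x := hF.branchRank_inj (hwz.trans hzx) (by omega)
    exact this ▸ hw
  funext c
  exact Subtype.ext ((key A B hA hB h c).antisymm (key B A hB hA h.symm c))

/-- The only vertex `x` of column `c` over row `i`, if there is one, determines the black tile
there: going back by the rank of `x` gives its start. -/
theorem LowerChain.existsUnique_pastedTiles (hF : LowerChain T)
    (hA : ∀ c, A (c + 1) = rho (A c)) (i : Fin n) (c : ZMod N) :
    ∃! t, t ∈ pastedTiles ℓ A ∧ t.Covers i c := by
  have hcov : ∀ t ∈ pastedTiles ℓ A, t.Covers i c → t.color = Color.black →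
      ∃ x ∈ (A c).1, i ∈ interval ℓ x ∧
        t = ⟨Color.black, interval ℓ x, c - branchRank ℓ x, beta ℓ (interval ℓ x)⟩ := by
    rintro t ht ⟨hi, j, hj, hc⟩ hb
    obtain ⟨x, hx, hxr, h0, hw⟩ := (hF.mem_pastedTiles_black hA hb).1 ht
    obtain ⟨y, hy, hyx, hr⟩ := hF.exists_mem_add (ℓ := ℓ) hA hx (j := j)
      (by rw [hxr, ← hw]; omega)
    rw [hc] at hy
    have hyr := hyx.trans hxr
    refine ⟨y, hy, hyr ▸ hi, Tile.ext hb hyr.symm ?_ (by rw [hw, hyr])⟩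
    rw [← hc, hr, h0, zero_add, add_sub_cancel_right]
  by_cases hy : YellowIn ℓ (A c) i
  · refine ⟨⟨Color.yellow, {i}, c, 1⟩, ⟨?_, ?_⟩, ?_⟩
    · exact (mem_pastedTiles_yellow rfl).2 ⟨rfl, i, rfl, hy⟩
    · exact ⟨Finset.mem_singleton_self i, 0, Nat.one_pos, by simp⟩
    · rintro t ⟨ht, hti⟩
      cases hcol : t.color with
      | black =>
        obtain ⟨x, hx, hix, -⟩ := hcov t ht hti hcol
        exact absurd hix (hy x hx)
      | yellow =>
        obtain ⟨hw, k, hk, -⟩ := (mem_pastedTiles_yellow hcol).1 ht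
        obtain ⟨hi, j, hj, hc⟩ := hti
        rw [hk, Finset.mem_singleton] at hi
        have hj0 : j = 0 := by omega
        rw [hj0, Nat.cast_zero, add_zero] at hc
        exact Tile.ext hcol (by rw [hk, hi]) hc hw
  · have hy' := hy
    unfold YellowIn at hy'
    push Not at hy'
    obtain ⟨x, hx, hix⟩ := hy'
    refine ⟨⟨Color.black, interval ℓ x, c - branchRank ℓ x, beta ℓ (interval ℓ x)⟩,
      ⟨?_, ?_⟩, ?_⟩
    · obtain ⟨y, hy, hyx, h0⟩ := hF.exists_mem_sub (ℓ := ℓ) hA hx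
      exact (hF.mem_pastedTiles_black hA rfl).2 ⟨y, hy, hyx, h0, rfl⟩
    · exact ⟨hix, _, branchRank_lt_beta x, sub_add_cancel _ _⟩
    · rintro t ⟨ht, hti⟩
      cases hcol : t.color with
      | black =>
        obtain ⟨z, hz, hiz, rfl⟩ := hcov t ht hti hcol
        rw [hF.eq_of_mem_interval hx hz hix hiz]
      | yellow =>
        obtain ⟨hw, k, hk, hyel⟩ := (mem_pastedTiles_yellow hcol).1 ht
        obtain ⟨hi, j, hj, hc⟩ := hti
        rw [hk, Finset.mem_singleton] at hi
        have hj0 : j = 0 := by omega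
        rw [hj0, Nat.cast_zero, add_zero] at hc
        rw [hc, ← hi] at hyel
        exact absurd hyel hy

theorem LowerChain.exists_isBranchMax_of_mem_pastedTiles (hF : LowerChain T)
    (hA : ∀ c, A (c + 1) = rho (A c)) {t : Tile n N} (ht : t ∈ pastedTiles ℓ A)
    (hb : t.color = Color.black) :
    ∃ z ∈ (A (t.next - 1)).1, interval ℓ z = t.rows ∧ IsBranchMax ℓ z := by
  obtain ⟨x, hx, hxr, h0, hw⟩ := (hF.mem_pastedTiles_black hA hb).1 ht
  have hpos := IsInterval.beta_pos ⟨x, hxr⟩ (ℓ := ℓ)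
  obtain ⟨z, hz, hzx, hr⟩ := hF.exists_mem_add (ℓ := ℓ) hA hx (j := beta ℓ t.rows - 1)
    (by rw [hxr]; omega)
  have hzr := hzx.trans hxr
  refine ⟨z, ?_, hzr, isBranchMax_of_beta_le (by rw [hzr]; omega)⟩
  rwa [Nat.cast_sub hpos, Nat.cast_one, ← hw, ← add_sub_assoc] at hz

/-- A cyclic rowmotion sequence gives an `𝓘(T)`-tiling. -/
theorem LowerChain.isFamilyTiling_pastedTiles (hF : LowerChain T)
    (hconv : ∀ x : T, (interval ℓ x : Set (Fin n)).OrdConnected) (hN : 0 < N)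
    (hA : ∀ c, A (c + 1) = rho (A c)) : IsFamilyTiling ℓ ⟨N, pastedTiles ℓ A⟩ := by
  have hstart : ∀ (c : ZMod N) x, x ∈ (A c).1 → IsBranchMin ℓ x →
      Arrangement.BlackStartsAt ⟨N, pastedTiles ℓ A⟩ (interval ℓ x) c := by
    intro c x hx hmin
    exact ⟨⟨Color.black, interval ℓ x, c, beta ℓ (interval ℓ x)⟩,
      (hF.mem_pastedTiles_black hA rfl).2
        ⟨x, hx, rfl, branchRank_eq_zero_iff.2 hmin, rfl⟩, rfl, rfl, rfl⟩
  have hprev : ∀ c, A c = rho (A (c - 1)) := fun c => by rw [← hA, sub_add_cancel]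
  have hyellow : ∀ (i : Fin n) (c : ZMod N),
      Arrangement.YellowAt ⟨N, pastedTiles ℓ A⟩ i c ↔ YellowIn ℓ (A c) i := by
    intro i c
    constructor
    · rintro ⟨t, ht, hcol, hi, j, hj, hc⟩
      obtain ⟨hw, k, hk, hyel⟩ := (mem_pastedTiles_yellow hcol).1 ht
      rw [hk, Finset.mem_singleton] at hi
      have hj0 : j = 0 := by omega
      rw [hj0, Nat.cast_zero, add_zero] at hc
      rwa [hc, ← hi] at hyel
    · intro hy
      exact ⟨⟨Color.yellow, {i}, c, 1⟩, (mem_pastedTiles_yellow rfl).2 ⟨rfl, i, rfl, hy⟩, rfl,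
        Finset.mem_singleton_self i, 0, Nat.one_pos, by simp⟩
  refine ⟨⟨hN, fun t ht => width_le_of_mem_pastedTiles hN ht,
    hF.existsUnique_pastedTiles hA⟩, ?_, ?_, ?_, ?_, ?_⟩
  · intro t ht hb
    obtain ⟨x, -, hxr, -, hw⟩ := (hF.mem_pastedTiles_black hA hb).1 ht
    exact ⟨x, by simp only [hw, hxr]⟩
  · intro t ht hy
    obtain ⟨hw, k, hk, -⟩ := (mem_pastedTiles_yellow hy).1 ht
    exact ⟨by rw [hk, Finset.card_singleton], hw⟩
  · intro t ht hb hcard i hi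
    obtain ⟨z, hz, hzr, hmax⟩ := hF.exists_isBranchMax_of_mem_pastedTiles hA ht hb
    obtain ⟨k, hk⟩ := Finset.card_eq_one.1 hcard
    rw [hk, Finset.mem_singleton] at hi
    rw [hyellow, hprev]
    exact hF.yellowIn_rho hz hmax (by rw [hzr, hk, hi])
  · intro t ht hb hcard
    obtain ⟨z, hz, hzr, hmax⟩ := hF.exists_isBranchMax_of_mem_pastedTiles hA ht hb
    obtain ⟨p, hp⟩ := hF.exists_maximal_proper_familyPartition (ℓ := ℓ) hcard
    refine ⟨p, hp, fun K hK => ?_⟩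
    have hKmax := hF.maximal_of_mem_proper_familyPartition hcard hp hK
    obtain ⟨x, rfl, hmin⟩ := hKmax.prop.1.exists_isBranchMin
    refine hstart _ x ?_ hmin
    rw [hprev]
    exact hF.mem_rho_of_maximal_proper hz hmax (hzr ▸ hKmax) hmin
  · intro c J hJ
    simp only [Arrangement.IsMaxYellow, hyellow] at hJ
    obtain ⟨p, hp⟩ := hF.exists_maximal_familyPartition (ℓ := ℓ) J
    refine ⟨p, hp, fun K hK => ?_⟩
    have hKmax := hF.maximal_of_mem_familyPartition hp hK
    obtain ⟨x, rfl, hmin⟩ := hKmax.prop.1.exists_isBranchMin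
    refine hstart _ x ?_ hmin
    rw [hA]
    exact hF.mem_rho_of_maximal_yellow hconv hJ hKmax hmin

end Pasted

/-! ### The antichains of a tiling -/

section FromTiling

variable {T : Type*} [PartialOrder T] {n : ℕ} {ℓ : Leaf T ≃ Fin n} {a : Arrangement n}

theorem Arrangement.IsTiling.eq_of_covers (ha : a.IsTiling) {t t' : Tile n a.columns}
    (ht : t ∈ a.tiles) (ht' : t' ∈ a.tiles) {i : Fin n} {c : ZMod a.columns}
    (h : t.Covers i c) (h' : t'.Covers i c) : t = t' :=
  (ha.existsUnique i c).unique ⟨ht, h⟩ ⟨ht', h'⟩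

theorem Arrangement.IsTiling.offset_inj (ha : a.IsTiling) {t : Tile n a.columns}
    (ht : t ∈ a.tiles) {j k : ℕ} (hj : j < t.width) (hk : k < t.width)
    (h : t.start + (j : ZMod a.columns) = t.start + (k : ZMod a.columns)) : j = k := by
  have hw := ha.width_le t ht
  have h' := (ZMod.natCast_eq_natCast_iff' j k a.columns).1 (add_left_cancel h)
  rwa [Nat.mod_eq_of_lt (by omega), Nat.mod_eq_of_lt (by omega)] at h'

theorem IsFamilyTiling.isInterval_rows (ha : IsFamilyTiling ℓ a) {t : Tile n a.columns}
    (ht : t ∈ a.tiles) (hb : t.color = Color.black) : IsInterval ℓ t.rows := by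
  obtain ⟨x, hx⟩ := ha.black_shape t ht hb
  exact ⟨x, congrArg Prod.fst hx⟩

theorem IsFamilyTiling.width_eq_beta (ha : IsFamilyTiling ℓ a) {t : Tile n a.columns}
    (ht : t ∈ a.tiles) (hb : t.color = Color.black) : t.width = beta ℓ t.rows := by
  obtain ⟨x, hx⟩ := ha.black_shape t ht hb
  have h1 : interval ℓ x = t.rows := congrArg Prod.fst hx
  have h2 : beta ℓ (interval ℓ x) = t.width := congrArg Prod.snd hx
  rw [← h2, h1]

variable (ℓ a) in
/-- The vertices read off from column `c`: the `j`-th column of a black tile with rows `I`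
gives the `j`-th vertex of the branch of `I`. -/
def columnVertices (c : ZMod a.columns) : Set T :=
  {x | ∃ t ∈ a.tiles, t.color = Color.black ∧ t.rows = interval ℓ x ∧
    t.start + (branchRank ℓ x : ZMod a.columns) = c}

variable [Finite T]

/-- Comparable vertices share a row, so they come from one tile. They also have the same offset in
it, as no tile is wider than the cylinder, so they have the same rank and coincide. -/
theorem IsFamilyTiling.isAntichain_columnVertices (ha : IsFamilyTiling ℓ a) (hF : LowerChain T)
    (c : ZMod a.columns) : IsAntichain (· ≤ ·) (columnVertices ℓ a c) := by
  rintro x ⟨t, ht, hb, hr, hs⟩ y ⟨t', ht', hb', hr', hs'⟩ hne hxy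
  obtain ⟨i, hi⟩ := interval_nonempty ℓ y
  have hw : branchRank ℓ x < t.width := by
    rw [ha.width_eq_beta ht hb, hr]
    exact branchRank_lt_beta x
  have hw' : branchRank ℓ y < t'.width := by
    rw [ha.width_eq_beta ht' hb', hr']
    exact branchRank_lt_beta y
  obtain rfl := ha.isTiling.eq_of_covers ht ht' (i := i) (c := c)
    ⟨hr ▸ interval_anti ℓ hxy hi, _, hw, hs⟩ ⟨hr' ▸ hi, _, hw', hs'⟩
  exact hne (hF.branchRank_inj (hr.symm.trans hr')
    (ha.isTiling.offset_inj ht hw hw' (hs.trans hs'.symm)))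

/-- The antichain read off from column `c`. -/
def IsFamilyTiling.columnAntichain (ha : IsFamilyTiling ℓ a) (hF : LowerChain T)
    (c : ZMod a.columns) : Antichains T :=
  ⟨columnVertices ℓ a c, ha.isAntichain_columnVertices hF c⟩

theorem IsFamilyTiling.yellowAt_iff (ha : IsFamilyTiling ℓ a) (hF : LowerChain T) {i : Fin n}
    {c : ZMod a.columns} : a.YellowAt i c ↔ YellowIn ℓ (ha.columnAntichain hF c) i := by
  constructor
  · rintro ⟨t, ht, hy, hcov⟩ x ⟨t', ht', hb, hr, hs⟩ hi
    have hw : branchRank ℓ x < t'.width := by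
      rw [ha.width_eq_beta ht' hb, hr]
      exact branchRank_lt_beta x
    obtain rfl := ha.isTiling.eq_of_covers ht ht' hcov ⟨hr ▸ hi, _, hw, hs⟩
    rw [hy] at hb
    cases hb
  · intro hy
    obtain ⟨t, ⟨ht, hi, j, hj, hc⟩, -⟩ := ha.isTiling.existsUnique i c
    cases hcol : t.color with
    | yellow => exact ⟨t, ht, hcol, hi, j, hj, hc⟩
    | black =>
      rw [ha.width_eq_beta ht hcol] at hj
      obtain ⟨x, hx, hr⟩ := hF.exists_branchRank_eq hj
      exact absurd (hx ▸ hi) (hy x ⟨t, ht, hcol, hx.symm, hr ▸ hc⟩)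

theorem IsFamilyTiling.mem_columnAntichain_of_blackStartsAt (ha : IsFamilyTiling ℓ a)
    (hF : LowerChain T) {x : T} {c : ZMod a.columns} (h : a.BlackStartsAt (interval ℓ x) c)
    (hmin : IsBranchMin ℓ x) : x ∈ (ha.columnAntichain hF c).1 := by
  obtain ⟨t, ht, hb, hr, hs⟩ := h
  refine ⟨t, ht, hb, hr, ?_⟩
  rw [branchRank_eq_zero_iff.2 hmin, Nat.cast_zero, add_zero, hs]

/-- Agreement in every row is enough for equality of the two antichains, since each has at most one
vertex per row. The cases are a yellow row, the last column of a black tile, and an earlier column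
of one. -/
theorem IsFamilyTiling.row_succ (ha : IsFamilyTiling ℓ a) (hF : LowerChain T)
    (hconv : ∀ x : T, (interval ℓ x : Set (Fin n)).OrdConnected) (c : ZMod a.columns)
    (i : Fin n) :
    (∃ x ∈ (ha.columnAntichain hF (c + 1)).1, x ∈ (rho (ha.columnAntichain hF c)).1 ∧
      i ∈ interval ℓ x) ∨
    (YellowIn ℓ (ha.columnAntichain hF (c + 1)) i ∧
      YellowIn ℓ (rho (ha.columnAntichain hF c)) i) := by
  by_cases hy : YellowIn ℓ (ha.columnAntichain hF c) i
  · left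
    obtain ⟨J, hiJ, hJ⟩ := (Set.toFinite {K : Finset (Fin n) |
      (∃ i j, i ≤ j ∧ K = Finset.Icc i j) ∧ ∀ i ∈ K, YellowIn ℓ (ha.columnAntichain hF c) i}
      ).exists_le_maximal (a := {i}) ⟨⟨i, i, le_rfl, by simp⟩, by simpa using hy⟩
    have hJ' : a.IsMaxYellow J c := by
      simp only [Arrangement.IsMaxYellow, ha.yellowAt_iff hF]
      exact hJ
    obtain ⟨p, hp, hstart⟩ := ha.t2 c J hJ'
    obtain ⟨K, hK, hiK⟩ := p.exists_mem (hiJ (Finset.mem_singleton_self i))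
    have hKmax := hF.maximal_of_mem_familyPartition hp hK
    obtain ⟨x, rfl, hmin⟩ := hKmax.prop.1.exists_isBranchMin
    exact ⟨x, ha.mem_columnAntichain_of_blackStartsAt hF (hstart _ hK) hmin,
      hF.mem_rho_of_maximal_yellow hconv hJ hKmax hmin, hiK⟩
  · unfold YellowIn at hy
    push Not at hy
    obtain ⟨z, hz, hiz⟩ := hy
    obtain ⟨t, ht, hb, hr, hs⟩ := id hz
    by_cases hmax : IsBranchMax ℓ z
    · have hnext : t.next = c + 1 := by
        rw [Tile.next, ha.width_eq_beta ht hb, hr, ← hF.branchRank_add_one_eq_beta hmax,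
          Nat.cast_add, Nat.cast_one, ← add_assoc, hs]
      have hpos : 0 < t.rows.card := Finset.card_pos.2 ⟨i, hr ▸ hiz⟩
      by_cases hcard : t.rows.card = 1
      · right
        have h1 := ha.t1_one t ht hb hcard i (hr ▸ hiz)
        rw [hnext, ha.yellowAt_iff hF] at h1
        obtain ⟨k, hk⟩ := Finset.card_eq_one.1 hcard
        rw [← hr, hk, Finset.mem_singleton] at hiz
        exact ⟨h1, hF.yellowIn_rho hz hmax (by rw [← hr, hk, hiz])⟩
      · left
        have hcard : 2 ≤ t.rows.card := by omega
        obtain ⟨p, hp, hstart⟩ := ha.t1_two t ht hb hcard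
        obtain ⟨K, hK, hiK⟩ := p.exists_mem (show i ∈ t.rows from hr ▸ hiz)
        have hKmax := hF.maximal_of_mem_proper_familyPartition hcard hp hK
        obtain ⟨x, rfl, hmin⟩ := hKmax.prop.1.exists_isBranchMin
        have := hstart _ hK
        rw [hnext] at this
        exact ⟨x, ha.mem_columnAntichain_of_blackStartsAt hF this hmin,
          hF.mem_rho_of_maximal_proper hz hmax (hr ▸ hKmax) hmin, hiK⟩
    · left
      obtain ⟨y, hzy, hy⟩ := exists_covBy_of_not_isBranchMax hmax
      refine ⟨y, ⟨t, ht, hb, hr.trans hy.symm, ?_⟩, hF.mem_rho_of_covBy hz hzy, hy ▸ hiz⟩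
      rw [hF.branchRank_of_covBy hzy hy.symm, Nat.cast_add, Nat.cast_one, ← add_assoc, hs]

/-- Consecutive columns of an `𝓘(T)`-tiling are related by rowmotion. -/
theorem IsFamilyTiling.columnAntichain_succ (ha : IsFamilyTiling ℓ a) (hF : LowerChain T)
    (hconv : ∀ x : T, (interval ℓ x : Set (Fin n)).OrdConnected) (c : ZMod a.columns) :
    ha.columnAntichain hF (c + 1) = rho (ha.columnAntichain hF c) := by
  refine Subtype.ext (Set.Subset.antisymm (fun x hx => ?_) fun x hx => ?_)
  all_goals
    obtain ⟨i, hi⟩ := interval_nonempty ℓ x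
    rcases ha.row_succ hF hconv c i with ⟨y, hy, hy', hiy⟩ | ⟨h1, h2⟩
  · exact hF.eq_of_mem_interval hx hy hi hiy ▸ hy'
  · exact absurd hi (h1 x hx)
  · exact hF.eq_of_mem_interval hx hy' hi hiy ▸ hy
  · exact absurd hi (h2 x hx)

/-- A tiling is recovered from its antichains. -/
theorem IsFamilyTiling.pastedTiles_columnAntichain (ha : IsFamilyTiling ℓ a)
    (hF : LowerChain T) (hconv : ∀ x : T, (interval ℓ x : Set (Fin n)).OrdConnected) :
    pastedTiles ℓ (ha.columnAntichain hF) = a.tiles := by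
  ext t
  cases hcol : t.color with
  | black =>
    rw [hF.mem_pastedTiles_black (ha.columnAntichain_succ hF hconv) hcol]
    constructor
    · rintro ⟨x, ⟨t', ht', hb', hr', hs'⟩, hxr, h0, hw⟩
      rw [h0, Nat.cast_zero, add_zero] at hs'
      have hrows := hr'.trans hxr
      have : t' = t := Tile.ext (hb'.trans hcol.symm) hrows hs'
        (by rw [ha.width_eq_beta ht' hb', hrows, hw])
      exact this ▸ ht'
    · intro ht
      obtain ⟨x, hx, hmin⟩ := (ha.isInterval_rows ht hcol).exists_isBranchMin
      exact ⟨x, ha.mem_columnAntichain_of_blackStartsAt hF ⟨t, ht, hcol, hx.symm, rfl⟩ hmin, hx,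
        branchRank_eq_zero_iff.2 hmin, ha.width_eq_beta ht hcol⟩
  | yellow =>
    rw [mem_pastedTiles_yellow hcol]
    constructor
    · rintro ⟨hw, i, hi, hy⟩
      rw [← ha.yellowAt_iff hF] at hy
      obtain ⟨t', ht', hcol', hi', j, hj, hc⟩ := hy
      obtain ⟨hcard, hw'⟩ := ha.yellow_shape t' ht' hcol'
      obtain ⟨k, hk⟩ := Finset.card_eq_one.1 hcard
      rw [hk, Finset.mem_singleton] at hi'
      have hj0 : j = 0 := by omega
      rw [hj0, Nat.cast_zero, add_zero] at hc
      have : t' = t := Tile.ext (hcol'.trans hcol.symm) (by rw [hk, hi, hi']) hc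
        (hw'.trans hw.symm)
      exact this ▸ ht'
    · intro ht
      obtain ⟨hcard, hw⟩ := ha.yellow_shape t ht hcol
      obtain ⟨i, hi⟩ := Finset.card_eq_one.1 hcard
      refine ⟨hw, i, hi, (ha.yellowAt_iff hF).1 ⟨t, ht, hcol, ?_, 0, by omega, by simp⟩⟩
      rw [hi]
      exact Finset.mem_singleton_self i

end FromTiling

/-! ### Orbits and periods -/

section Orbit

variable {T : Type*} [PartialOrder T] [Finite T] {n N : ℕ} {ℓ : Leaf T ≃ Fin n}

theorem minimalPeriod_rowmotion_pos (A : Antichains T) :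
    0 < Function.minimalPeriod (rowmotion T) A :=
  Function.minimalPeriod_pos_of_mem_periodicPts ((rowmotion T).injective.mem_periodicPts A)

theorem iterate_rowmotion_succ (A : Antichains T)
    (hN : Function.minimalPeriod (rowmotion T) A = N) (c : ZMod N) :
    (rowmotion T)^[(c + 1).val] A = rho ((rowmotion T)^[c.val] A) := by
  have hpos := minimalPeriod_rowmotion_pos A
  have hiter := fun m => Function.iterate_mod_minimalPeriod_eq (f := rowmotion T) (x := A) (n := m)
  rw [hN] at hpos hiter
  have : NeZero N := ⟨hpos.ne'⟩
  -- This form handles the wrap-around from the last column to column `0`: exponents matter only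
  -- modulo the period.
  have h1 : c + 1 = ((c.val + 1 : ℕ) : ZMod N) := by
    rw [Nat.cast_add, ZMod.natCast_zmod_val, Nat.cast_one]
  rw [h1, ZMod.val_natCast, hiter, Function.iterate_succ_apply']
  rfl

theorem eq_iterate_rowmotion [NeZero N] {A : ZMod N → Antichains T}
    (hA : ∀ c, A (c + 1) = rho (A c)) (c : ZMod N) (k : ℕ) :
    A (c + k) = (rowmotion T)^[k] (A c) := by
  induction k with
  | zero => simp
  | succ k ih =>
    rw [Function.iterate_succ_apply', ← ih, Nat.cast_add, Nat.cast_one, ← add_assoc, hA]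
    rfl

theorem tilingFrom_eq (A : Antichains T) (hN : Function.minimalPeriod (rowmotion T) A = N) :
    tilingFrom ℓ A = ⟨N, pastedTiles ℓ fun c : ZMod N => (rowmotion T)^[c.val] A⟩ := by
  subst hN
  rfl

/-- A rotation by `k` fixing the tiles fixes the sequence of antichains, so the minimal period `N`
divides `k.val < N`. -/
theorem LowerChain.isPrimitive_tilingFrom (hF : LowerChain T) (A : Antichains T) :
    (tilingFrom ℓ A).IsPrimitive := by
  obtain ⟨N, hN⟩ : ∃ N, Function.minimalPeriod (rowmotion T) A = N := ⟨_, rfl⟩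
  have hpos := hN ▸ minimalPeriod_rowmotion_pos A
  have : NeZero N := ⟨hpos.ne'⟩
  rw [tilingFrom_eq A hN]
  intro k hk
  have hstep := iterate_rowmotion_succ A hN
  change ZMod N at k
  have hshift := pastedTiles_shift ℓ (fun c : ZMod N => (rowmotion T)^[c.val] A) (-k)
  rw [neg_neg] at hshift
  have heq := hF.pastedTiles_injective (ℓ := ℓ)
    (B := fun c : ZMod N => (rowmotion T)^[c.val] A)
    (fun c => by rw [add_right_comm]; exact hstep (c + -k)) hstep (hshift.trans hk)
  have h0 := congrFun heq k
  simp only [add_neg_cancel, ZMod.val_zero, Function.iterate_zero, id_eq] at h0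
  have hdvd := (show Function.IsPeriodicPt (rowmotion T) k.val A from h0.symm).minimalPeriod_dvd
  rw [hN] at hdvd
  exact (ZMod.val_eq_zero k).1 (Nat.eq_zero_of_dvd_of_lt hdvd (ZMod.val_lt k))

theorem LowerChain.isFamilyTiling_tilingFrom (hF : LowerChain T)
    (hconv : ∀ x : T, (interval ℓ x : Set (Fin n)).OrdConnected) (A : Antichains T) :
    IsFamilyTiling ℓ (tilingFrom ℓ A) :=
  hF.isFamilyTiling_pastedTiles hconv (minimalPeriod_rowmotion_pos A)
    (iterate_rowmotion_succ A rfl)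

theorem LowerChain.sameCycle_of_rotated (hF : LowerChain T) {A B : Antichains T}
    (h : Arrangement.Rotated (tilingFrom ℓ A) (tilingFrom ℓ B)) :
    (rowmotion T).SameCycle A B := by
  obtain ⟨N, hN⟩ : ∃ N, Function.minimalPeriod (rowmotion T) A = N := ⟨_, rfl⟩
  obtain ⟨M, hM⟩ : ∃ M, Function.minimalPeriod (rowmotion T) B = M := ⟨_, rfl⟩
  have hpos := hN ▸ minimalPeriod_rowmotion_pos A
  have : NeZero N := ⟨hpos.ne'⟩
  rw [tilingFrom_eq A hN, tilingFrom_eq B hM] at h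
  -- With the tile sets replaced by variables, `cases` can identify the column counts `M` and `N`.
  generalize hS : (pastedTiles ℓ fun c : ZMod N => (rowmotion T)^[c.val] A) = S at h
  generalize hS' : (pastedTiles ℓ fun c : ZMod M => (rowmotion T)^[c.val] B) = S' at h
  cases h with
  | intro _ _ k =>
    have hstep := iterate_rowmotion_succ A hN
    have hshift := pastedTiles_shift ℓ (fun c : ZMod N => (rowmotion T)^[c.val] A) (-k)
    rw [neg_neg, hS] at hshift
    have heq := hF.pastedTiles_injective (ℓ := ℓ)
      (fun c => by rw [add_right_comm]; exact hstep (c + -k))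
      (iterate_rowmotion_succ B hM) (hshift.trans hS'.symm)
    have h0 := congrFun heq 0
    simp only [ZMod.val_zero, Function.iterate_zero, id_eq] at h0
    refine ⟨((0 + -k : ZMod N).val : ℤ), ?_⟩
    rw [zpow_natCast, ← Equiv.Perm.iterate_eq_pow]
    exact h0

theorem IsFamilyTiling.exists_tilingFrom_eq {a : Arrangement n} (ha : IsFamilyTiling ℓ a)
    (hprim : a.IsPrimitive) (hF : LowerChain T)
    (hconv : ∀ x : T, (interval ℓ x : Set (Fin n)).OrdConnected) :
    ∃ A : Antichains T, tilingFrom ℓ A = a := by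
  have hpos := ha.isTiling.columns_pos
  have hstep := ha.columnAntichain_succ hF hconv
  have htiles := ha.pastedTiles_columnAntichain hF hconv
  generalize ha.columnAntichain hF = A at hstep htiles
  obtain ⟨N, S⟩ := a
  dsimp only at hpos A hstep htiles
  subst htiles
  have : NeZero N := ⟨hpos.ne'⟩
  have hiter := eq_iterate_rowmotion hstep
  have hN : Function.minimalPeriod (rowmotion T) (A 0) = N := by
    refine Nat.dvd_antisymm ?_ ?_
    · refine Function.IsPeriodicPt.minimalPeriod_dvd ?_
      change (rowmotion T)^[N] (A 0) = A 0
      rw [← hiter, ZMod.natCast_self, add_zero]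
    -- Shifting by the minimal period fixes the sequence and hence its tiles, so primitivity makes
    -- this period zero in `ZMod N`.
    · rw [← ZMod.natCast_eq_zero_iff]
      refine neg_eq_zero.1 (hprim _ ?_)
      change Tile.rotate (-_) '' pastedTiles ℓ A = pastedTiles ℓ A
      rw [← pastedTiles_shift]
      congr 1
      funext c
      have hc : c = 0 + (c.val : ZMod N) := by simp
      rw [hc, add_right_comm, hiter, hiter, hiter, Function.iterate_minimalPeriod]
  refine ⟨A 0, ?_⟩
  rw [tilingFrom_eq _ hN]
  congr 2
  funext c
  rw [← hiter, ZMod.natCast_zmod_val, zero_add]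

end Orbit

end TreeRowmotion

theorem mainTheorem1 {T : Type*} [PartialOrder T] [Finite T]
    (hT : TreeRowmotion.IsRootedTree T) (e : TreeRowmotion.PlaneEmbedding T)
    {n : ℕ} (ℓ : TreeRowmotion.Leaf T ≃ Fin n) (hℓ : e.IsLeftToRight ℓ) :
    Set.BijOn (TreeRowmotion.tau ℓ) Set.univ
      {q : TreeRowmotion.CylArrangement n |
        ∃ a : TreeRowmotion.Arrangement n,
          TreeRowmotion.IsFamilyTiling ℓ a ∧ a.IsPrimitive ∧ Quotient.mk _ a = q} := by
  have hF := hT.lowerChain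
  have hconv := TreeRowmotion.ordConnected_interval ℓ hT e hℓ
  refine ⟨?_, ?_, ?_⟩
  · rintro ⟨A⟩ -
    exact ⟨_, hF.isFamilyTiling_tilingFrom hconv A, hF.isPrimitive_tilingFrom A, rfl⟩
  · rintro ⟨A⟩ - ⟨B⟩ - h
    exact Quotient.sound (hF.sameCycle_of_rotated (Quotient.exact h))
  · rintro _ ⟨a, ha, hprim, rfl⟩
    obtain ⟨A, rfl⟩ := ha.exists_tilingFrom_eq hprim hF hconv
    exact ⟨Quotient.mk _ A, trivial, rfl⟩
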